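/- For $t>0$, $x>0$ and real $\alpha_1,\beta_1,\alpha_2,\beta_2$ put $$H_+(t,x)=H_+(\alpha_1,\beta_1,\alpha_2,\beta_2;t,x)=\frac{\mathrm{Re}}{\pi}\int_0^\infty e^{-ix\omega}\exp\!\big(-t\omega^{\alpha_1}e^{\frac{i\pi}{2}\beta_1}-t\omega^{\alpha_2}e^{\frac{i\pi}{2}\beta_2}\big)\,d\omega .$$ Let $M=\max(\alpha_1,\alpha_2)$, $m=\min(\alpha_1,\alpha_2)$, and let $(u,v)=\big(\frac{\alpha_1-\beta_1}{2},\frac{\alpha_2-\beta_2}{2}\big)$ if $\alpha_1\ge\alpha_2$ and $(u,v)=\big(\frac{\alpha_2-\beta_2}{2},\frac{\alpha_1-\beta_1}{2}\big)$ if $\alpha_1<\alpha_2$. In the rational case $\alpha_1=\frac lk$, $\beta_1=\frac{l-2a}{k}$, $\alpha_2=\frac pq$, $\beta_2=\frac{p-2b}{q}$, with integers $l,k,p,q>0$ and $a,b\in\mathbb Z$ (so that $\frac{\alpha_1-\beta_1}{2}=\frac ak$, $\frac{\alpha_2-\beta_2}{2}=\frac bq$), let $m_1=\min(kp,lq)$;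 then $m_1u$ is an integer. Write $\Delta(n,c)$ for the list $\frac cn,\frac{c+1}n,\dots,\frac{c+n-1}n$ and ${}_PF_Q\big({a_1,\dots,a_P\atop b_1,\dots,b_Q};z\big)=\sum_{n\ge0}\frac{z^n}{n!}\frac{\prod_i(a_i)_n}{\prod_i(b_i)_n}$. **(A)** Let $0<\alpha_i<1$ and $|\beta_i|\le\alpha_i$ for $i=1,2$. Then the integral defining $H_+$ converges absolutely and $$H_+(t,x)=-\frac1\pi\sum_{r,n=0}^\infty\frac{(-t)^{n+r}}{n!\,r!}\,\frac{\Gamma(1+\alpha_1r+\alpha_2n)}{x^{1+\alpha_1r+\alpha_2n}}\,\sin\!\Big(\pi r\,\tfrac{\alpha_1-\beta_1}{2}+\pi n\,\tfrac{\alpha_2-\beta_2}{2}\Big),$$ the double series converging absolutely. In the rational case, moreover, $$H_+(t,x)=-\frac1\pi\sum_{r=0}^\infty\sum_{j=0}^{m_1-1}\frac{(-t)^{r+j}}{r!\,j!}\,\frac{\Gamma(1+Mj+mr)}{x^{1+Mj+rm}}\,\sin(r\pi v+j\pi u)\;{}_{1+lp}F_{m_1}\!\left({1,\ \Delta(lp,1+Mj+mr)\atop\Delta(m_1,1+j)};(-1)^{m_1u-m_1}\frac{t^{m_1}(lp)^{lp}}{m_1^{m_1}x^{lp}}\right),$$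 where the hypergeometric series, and the series over $r$ of the finite sums over $j$, converge absolutely. **(B)** Let $1<\alpha_i\le2$ and $|\beta_i|\le2-\alpha_i$ for $i=1,2$, and $\alpha_1\ne\alpha_2$. Then the integral defining $H_+$ converges absolutely and $$H_+(t,x)=\frac1{\pi M}\sum_{r,n=0}^\infty\frac{(-1)^{r+n}}{r!\,n!}\,\frac{x^n}{t^{\frac{1+n}M+(\frac mM-1)r}}\,\Gamma\!\big(\tfrac{1+n}M+\tfrac mMr\big)\sin\!\Big[\pi u\tfrac{1+n}M-\pi r\big(v-u\tfrac mM\big)\Big],$$ the double series converging absolutely. In the rational case, moreover, $$H_+(t,x)=\frac1{\pi M}\sum_{r=0}^\infty\sum_{j=0}^{lp-1}\frac{(-1)^{r+j}}{r!\,j!}\,\frac{x^j}{t^{\frac{1+j}M+(\frac mM-1)r}}\,\Gamma\!\big(\tfrac{1+j}M+\tfrac mMr\big)\sin\!\Big[\pi u\tfrac{1+j}M-\pi r\big(v-u\tfrac mM\big)\Big]\;{}_{1+m_1}F_{lp}\!\left({1,\ \Delta(m_1,\tfrac{1+j}M+\tfrac mMr)\atop\Delta(lp,1+j)};(-1)^{m_1u+lp}\frac{m_1^{m_1}x^{lp}}{t^{m_1}(lp)^{lp}}\right),$$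 where the hypergeometric series, and the series over $r$ of the finite sums over $j$, converge absolutely. -/

import Mathlib

open Real Set MeasureTheory

noncomputable section

/-- The integrand `e^{-ixω} exp(-t ω^α₁ e^{iπβ₁/2} - t ω^α₂ e^{iπβ₂/2})` of `H₊`, for `ω > 0`. -/
def levyIntegrand (α₁ β₁ α₂ β₂ t x ω : ℝ) : ℂ :=
  Complex.exp (-Complex.I * x * ω) *
    Complex.exp (-(t : ℂ) * ((ω ^ α₁ : ℝ) : ℂ) * Complex.exp (Complex.I * π / 2 * β₁)
      - (t : ℂ) * ((ω ^ α₂ : ℝ) : ℂ) * Complex.exp (Complex.I * π / 2 * β₂))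

/-- `H₊(α₁, β₁, α₂, β₂; t, x)`, the restriction to `x > 0` of the kernel of the two-scale
Lévy generator: `(Re / π) ∫₀^∞` of `levyIntegrand`. -/
def levyHplus (α₁ β₁ α₂ β₂ t x : ℝ) : ℝ :=
  (1 / π) * (∫ ω in Ioi (0 : ℝ), levyIntegrand α₁ β₁ α₂ β₂ t x ω).re

/-- The list `Δ(n, a) = (a/n, (a+1)/n, …, (a+n-1)/n)`. -/
def deltaList (n : ℕ) (a : ℝ) : List ℝ :=
  (List.range n).map fun i => (a + i) / n

/-- The Pochhammer symbol `(a)_n = a (a+1) ⋯ (a+n-1)`. -/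
def pochhammerSymbol (a : ℝ) (n : ℕ) : ℝ := (ascPochhammer ℝ n).eval a

/-- The `n`-th term of the generalized hypergeometric series with upper parameters `as` and
lower parameters `bs`, at `z`. -/
def hypergeomTerm (as bs : List ℝ) (z : ℝ) (n : ℕ) : ℝ :=
  z ^ n / (n.factorial : ℝ) *
    ((as.map fun a => pochhammerSymbol a n).prod / (bs.map fun b => pochhammerSymbol b n).prod)

/-- The generalized hypergeometric function `pFq(as; bs; z)`, with `p = as.length`,
`q = bs.length`. -/
def hypergeomPFQ (as bs : List ℝ) (z : ℝ) : ℝ := ∑' n : ℕ, hypergeomTerm as bs z n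

/-- Of two quantities `c₁`, `c₂` belonging to the exponents `α₁`, `α₂`, the one that belongs to the
larger exponent (`c₁` in case of a tie). -/
def atLarger (α₁ α₂ c₁ c₂ : ℝ) : ℝ := if α₂ ≤ α₁ then c₁ else c₂

/-- Of two quantities `c₁`, `c₂` belonging to the exponents `α₁`, `α₂`, the one that belongs to the
smaller exponent (`c₂` in case of a tie). -/
def atSmaller (α₁ α₂ c₁ c₂ : ℝ) : ℝ := if α₂ ≤ α₁ then c₂ else c₁

/-- `m₁ = min(kp, lq)`. -/
def mOne (l k p q : ℕ) : ℕ := min (k * p) (l * q)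

/-- The integer `m₁ u`, where `u = a/k` if `l/k ≥ p/q` and `u = b/q` otherwise
(see `mOneU_eq`). -/
def mOneU (l k p q : ℕ) (a b : ℤ) : ℤ := if k * p ≤ l * q then p * a else l * b

theorem mOneU_eq (l k p q : ℕ) (hk : 0 < k) (hq : 0 < q) (a b : ℤ) :
    (mOneU l k p q a b : ℝ)
      = mOne l k p q * atLarger ((l : ℝ) / k) ((p : ℝ) / q) ((a : ℝ) / k) ((b : ℝ) / q) := by
  have hk' : (0 : ℝ) < k := by exact_mod_cast hk
  have hq' : (0 : ℝ) < q := by exact_mod_cast hq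
  have key : ((p : ℝ) / q ≤ (l : ℝ) / k) ↔ k * p ≤ l * q := by
    rw [div_le_div_iff₀ hq' hk', mul_comm (p : ℝ)]
    exact_mod_cast Iff.rfl
  unfold mOneU mOne atLarger
  by_cases h : k * p ≤ l * q
  · rw [if_pos h, if_pos (key.2 h), min_eq_left h]
    push_cast
    field_simp
  · rw [if_neg h, if_neg (fun h' => h (key.1 h')), min_eq_right (le_of_not_ge h)]
    push_cast
    field_simp

end

/-!
The proof expands exponentials under the integral sign.

The starting point is the Gamma integral `∫₀^∞ ω ^ q exp (-z ω ^ b) dω` for complex `z` in the right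
half-plane (`integral_rpow_mul_cexp_neg_mul_rpow`), obtained from the real case by analytic
continuation in `z`. When `b` exceeds `a₁` and `a₂`, the integral
`∫₀^∞ exp (-z ω ^ b + p ω ^ a₁ + q ω ^ a₂) dω` may be computed by expanding the last two exponentials
and integrating term by term, because `|p| ω ^ a₁ + |q| ω ^ a₂` is dominated by any multiple of
`ω ^ b` (`hasSum_integral_cexp_rpow`).

For exponents `1 < m < M`, this applies with `b = M`: the oscillating factor `exp (-i x ω)` and the
factor with `ω ^ m` are expanded. For exponents below `1`, it is `exp (-i x ω)` that has to be kept,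
so `b = 1` and `z = i x` lies on the boundary of the half-plane. No contour has to be rotated: the
integral and the series at `z = ε + i x` are both dominated uniformly in `ε > 0`, the integral since
`|β| ≤ α < 1` makes `exp (-t ω ^ α exp (i π β / 2))` decay, and both pass to the limit
(`hasSum_integral_cexp_rpow_of_re_nonneg`). Real parts give the sine series.

In the rational case, one index is split into residue classes modulo an integer chosen so that each
step within a class changes the argument of `Γ` by an integer and that of the sine by a multiple
of `π`. The multiplication formula for Pochhammer symbols (`prod_pochhammerSymbol_deltaList`) turns
the sum over a class into a hypergeometric series (`HasSum.hypergeomPFQ_deltaList`).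
-/

/-! ### Pochhammer symbols and hypergeometric terms -/

theorem pochhammerSymbol_succ (a : ℝ) (n : ℕ) :
    pochhammerSymbol a (n + 1) = pochhammerSymbol a n * (a + n) :=
  ascPochhammer_succ_eval n a

theorem pochhammerSymbol_add (a : ℝ) (m n : ℕ) :
    pochhammerSymbol a (m + n)
      = pochhammerSymbol a m * ∏ i ∈ Finset.range n, (a + m + i) := by
  induction n with
  | zero => simp
  | succ n ih =>
    rw [← add_assoc, pochhammerSymbol_succ, ih, Finset.prod_range_succ]
    push_cast
    ring

theorem pochhammerSymbol_one (n : ℕ) : pochhammerSymbol 1 n = n.factorial := by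
  simp [pochhammerSymbol]

theorem pochhammerSymbol_mul_Gamma {s : ℝ} (hs : 0 < s) (n : ℕ) :
    pochhammerSymbol s n * Gamma s = Gamma (s + n) := by
  induction n with
  | zero => simp [pochhammerSymbol]
  | succ n ih =>
    have h : s + n ≠ 0 := by positivity
    rw [pochhammerSymbol_succ, mul_right_comm, ih, mul_comm, ← Gamma_add_one h]
    push_cast
    ring_nf

theorem pochhammerSymbol_one_add_mul_factorial (j n : ℕ) :
    pochhammerSymbol (1 + j) n * j.factorial = (j + n).factorial := by
  have h := pochhammerSymbol_mul_Gamma (s := 1 + j) (by positivity) n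
  rw [add_comm (1 : ℝ), Gamma_nat_eq_factorial] at h
  rw [add_comm (1 : ℝ), h, ← Gamma_nat_eq_factorial]
  push_cast
  ring_nf

/-- The multiplication formula for Pochhammer symbols:
`∏ᵢ ((c + i) / n)_k · n^(n k) = (c)_(n k)`, the product running over the list `Δ(n, c)`. -/
theorem prod_pochhammerSymbol_deltaList {n : ℕ} (hn : 0 < n) (c : ℝ) (k : ℕ) :
    ((deltaList n c).map fun a => pochhammerSymbol a k).prod * (n : ℝ) ^ (n * k)
      = pochhammerSymbol c (n * k) := by
  have hn' : (n : ℝ) ≠ 0 := by positivity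
  have hprod : ∀ k, ((deltaList n c).map fun a => pochhammerSymbol a k).prod
      = ∏ i ∈ Finset.range n, pochhammerSymbol ((c + i) / n) k := by
    intro k
    simp only [deltaList, List.bind_eq_flatMap, List.pure_def, ← List.map_eq_flatMap, List.map_map]
    rfl
  induction k with
  | zero => rw [hprod]; simp [pochhammerSymbol]
  | succ k ih =>
    rw [hprod] at ih ⊢
    rw [mul_add_one, pochhammerSymbol_add, ← ih, pow_add]
    have hpow : (n : ℝ) ^ n = ∏ i ∈ Finset.range n, (n : ℝ) := by simp
    simp only [pochhammerSymbol_succ]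
    rw [Finset.prod_mul_distrib, mul_mul_mul_comm, hpow, ← Finset.prod_mul_distrib]
    congr 1
    refine Finset.prod_congr rfl fun i _ => ?_
    push_cast
    field_simp
    ring

/-- The hypergeometric term with parameter lists `1, Δ(P, s)` and `Δ(Q, 1 + j)` is, up to the factor
`Γ(s) / j!`, the term of index `j + Q n` of a series with coefficients `Γ(s + P n) / (j + Q n)!`. -/
theorem hypergeomTerm_deltaList {P Q : ℕ} (hP : 0 < P) (hQ : 0 < Q) {s : ℝ} (hs : 0 < s)
    (j : ℕ) (w z : ℝ) (hz : z = w * ((P : ℝ) ^ P / (Q : ℝ) ^ Q)) (n : ℕ) :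
    Gamma s / j.factorial * hypergeomTerm (1 :: deltaList P s) (deltaList Q (1 + j)) z n
      = w ^ n * (Gamma (s + (P * n : ℕ)) / (j + Q * n).factorial) := by
  have hA := prod_pochhammerSymbol_deltaList hP s n
  have hB := prod_pochhammerSymbol_deltaList hQ (1 + j) n
  have hP' : (P : ℝ) ^ (P * n) ≠ 0 := by positivity
  have hQ' : (Q : ℝ) ^ (Q * n) ≠ 0 := by positivity
  rw [← pochhammerSymbol_mul_Gamma hs, ← pochhammerSymbol_one_add_mul_factorial]
  have hB0 : pochhammerSymbol (1 + j : ℝ) (Q * n) ≠ 0 := fun h => by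
    have := pochhammerSymbol_one_add_mul_factorial j (Q * n)
    rw [h, zero_mul] at this
    exact (Nat.cast_ne_zero.2 (Nat.factorial_ne_zero _)) this.symm
  rw [← hB] at hB0
  have hB1 := left_ne_zero_of_mul hB0
  rw [← hA, ← hB]
  simp only [hypergeomTerm, List.map_cons, List.prod_cons, pochhammerSymbol_one, hz]
  have : (n.factorial : ℝ) ≠ 0 := by positivity
  have : (j.factorial : ℝ) ≠ 0 := by positivity
  rw [mul_pow, div_pow, ← pow_mul, ← pow_mul]
  field_simp

/-! ### Regrouping a double series along residue classes -/

/-- In an absolutely convergent double series the second index may be split as `j + Q n` with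
`j < Q`, and the sum over `n` performed first. -/
theorem HasSum.sum_range_tsum {f : ℕ × ℕ → ℝ} {a : ℝ} (hf : HasSum f a) {Q : ℕ} (hQ : 0 < Q) :
    HasSum (fun r => ∑ j ∈ Finset.range Q, ∑' n, f (r, j + Q * n)) a := by
  have : NeZero Q := ⟨hQ.ne'⟩
  refine hf.prod_fiberwise fun r => ?_
  have hs : Summable fun n => f (r, n) := hf.summable.prod_factor r
  convert! hs.hasSum using 1
  obtain ⟨Q, rfl⟩ := Nat.exists_eq_succ_of_ne_zero hQ.ne'
  rw [Nat.sumByResidueClasses hs (Q + 1), Finset.sum_range]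
  rfl

theorem summable_comp_add_mul {f : ℕ × ℕ → ℝ} (hf : Summable f) {Q : ℕ} (hQ : 0 < Q) (r j : ℕ) :
    Summable fun n => f (r, j + Q * n) :=
  hf.comp_injective (i := fun n => (r, j + Q * n)) fun a b h => by
    simpa [hQ.ne'] using h

/-! ### Laplace-type integrals of power functions -/

/-- The Gamma integral with a complex rate `z` in the right half-plane. Both sides are holomorphic
in `z` and agree on the positive real axis. -/
theorem integral_rpow_mul_cexp_neg_mul_rpow {b q : ℝ} (hb : 0 < b) (hq : -1 < q) {z : ℂ}
    (hz : 0 < z.re) :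
    ∫ ω in Ioi (0 : ℝ), ((ω ^ q : ℝ) : ℂ) * Complex.exp (-z * ((ω ^ b : ℝ) : ℂ))
      = z ^ ((-(q + 1) / b : ℝ) : ℂ) * ((1 / b * Gamma ((q + 1) / b) : ℝ) : ℂ) := by
  -- the integral is the complex moment generating function of `-ω ^ b` for the density `ω ^ q`
  set d : ℝ → ENNReal := fun ω => ENNReal.ofReal (ω ^ q) with hd
  set μ : Measure ℝ := (volume.restrict (Ioi (0 : ℝ))).withDensity d with hμ
  set X : ℝ → ℝ := fun ω => -ω ^ b with hX
  have hdm : Measurable d := by fun_prop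
  have hdlt : ∀ᵐ ω ∂(volume.restrict (Ioi (0 : ℝ))), d ω < ⊤ := by simp [hd]
  have hdr : ∀ ω ∈ Ioi (0 : ℝ), (d ω).toReal = ω ^ q := fun ω hω =>
    ENNReal.toReal_ofReal (rpow_nonneg (le_of_lt hω) _)
  have hmgf : ∀ w : ℂ, ProbabilityTheory.complexMGF X μ w
      = ∫ ω in Ioi (0 : ℝ), ((ω ^ q : ℝ) : ℂ) * Complex.exp (-w * ((ω ^ b : ℝ) : ℂ)) := by
    intro w
    rw [ProbabilityTheory.complexMGF, hμ, integral_withDensity_eq_integral_toReal_smul hdm hdlt]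
    refine setIntegral_congr_fun measurableSet_Ioi fun ω hω => ?_
    simp only [hdr ω hω, hX, Complex.real_smul]
    push_cast
    ring_nf
  have hset : Ioi (0 : ℝ) ⊆ interior (ProbabilityTheory.integrableExpSet X μ) := by
    refine interior_maximal (fun t ht => ?_) isOpen_Ioi
    rw [ProbabilityTheory.integrableExpSet, mem_ofPred_eq, hμ,
      integrable_withDensity_iff_integrable_smul' hdm hdlt]
    refine (integrableOn_rpow_mul_exp_neg_mul_rpow hq hb ht).congr_fun (fun ω hω => ?_)
      measurableSet_Ioi
    simp only [hdr ω hω, hX, smul_eq_mul]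
    ring_nf
  have hopen : IsOpen {w : ℂ | 0 < w.re} := isOpen_lt continuous_const Complex.continuous_re
  have hf : AnalyticOnNhd ℂ (ProbabilityTheory.complexMGF X μ) {w : ℂ | 0 < w.re} :=
    ProbabilityTheory.analyticOnNhd_complexMGF.mono fun w hw => hset hw
  have hg : AnalyticOnNhd ℂ (fun w : ℂ => w ^ ((-(q + 1) / b : ℝ) : ℂ)
      * ((1 / b * Gamma ((q + 1) / b) : ℝ) : ℂ)) {w : ℂ | 0 < w.re} := by
    refine DifferentiableOn.analyticOnNhd (fun w hw => ?_) hopen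
    exact ((differentiableAt_id.cpow_const (Or.inl hw)).mul_const _).differentiableWithinAt
  rw [← hmgf]
  refine AnalyticOnNhd.eqOn_of_preconnected_of_frequently_eq hf hg
    (convex_halfSpace_re_gt 0).isPreconnected (z₀ := 1) (by simp) ?_ hz
  have hreal : ∀ r : ℝ, 0 < r → ProbabilityTheory.complexMGF X μ (r : ℂ)
      = (r : ℂ) ^ ((-(q + 1) / b : ℝ) : ℂ) * ((1 / b * Gamma ((q + 1) / b) : ℝ) : ℂ) := by
    intro r hr
    rw [hmgf, ← Complex.ofReal_cpow hr.le, ← Complex.ofReal_mul, ← mul_assoc,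
      ← integral_rpow_mul_exp_neg_mul_rpow hb hq hr, ← integral_complex_ofReal]
    congr 1
    ext ω
    push_cast
    rfl
  have htend : Filter.Tendsto (fun n : ℕ => ((1 + 1 / ((n : ℝ) + 1) : ℝ) : ℂ)) Filter.atTop
      (nhdsWithin 1 {1}ᶜ) := by
    refine tendsto_nhdsWithin_iff.2 ⟨?_, .of_forall fun n => ?_⟩
    · have := (Complex.continuous_ofReal.tendsto _).comp
        ((tendsto_one_div_add_atTop_nhds_zero_nat (𝕜 := ℝ)).const_add 1)
      simpa [Function.comp_def] using this
    · have : (1 + 1 / ((n : ℝ) + 1)) ≠ 1 := by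
        have : 0 < 1 / ((n : ℝ) + 1) := by positivity
        linarith
      rw [mem_compl_singleton_iff]
      norm_cast at this ⊢
  exact htend.frequently (.of_forall fun n => hreal _ (by positivity))

/-- A lower power is absorbed by any multiple of a higher one, up to a constant. -/
theorem exists_mul_rpow_le {a b : ℝ} (ha : 0 < a) (hab : a < b) (c : ℝ) {d : ℝ} (hd : 0 < d) :
    ∃ C, ∀ ω : ℝ, 0 < ω → c * ω ^ a ≤ d * ω ^ b + C := by
  set K : ℝ := (|c| / d) ^ (1 / (b - a)) with hK
  have hba : 0 < b - a := sub_pos.2 hab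
  have hK0 : 0 ≤ K := by positivity
  refine ⟨|c| * K ^ a, fun ω hω => ?_⟩
  have hle : c * ω ^ a ≤ |c| * ω ^ a :=
    mul_le_mul_of_nonneg_right (le_abs_self c) (by positivity)
  rcases le_total ω K with h | h
  · have : |c| * ω ^ a ≤ |c| * K ^ a := by gcongr
    have : 0 ≤ d * ω ^ b := by positivity
    linarith
  · have h1 : |c| / d ≤ ω ^ (b - a) := by
      have := rpow_le_rpow hK0 h hba.le
      rwa [hK, ← rpow_mul (by positivity), one_div_mul_cancel hba.ne', rpow_one] at this
    rw [div_le_iff₀ hd] at h1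
    have h2 : |c| * ω ^ a ≤ d * ω ^ b := by
      calc |c| * ω ^ a ≤ ω ^ (b - a) * d * ω ^ a := by gcongr
        _ = d * (ω ^ (b - a) * ω ^ a) := by ring
        _ = d * ω ^ b := by rw [← rpow_add hω, sub_add_cancel]
    have : 0 ≤ |c| * K ^ a := by positivity
    linarith

/-- `exp (c₁ ω ^ a₁ + c₂ ω ^ a₂ - d ω ^ b)` is integrable on the half-line as soon as `b` exceeds
`a₁` and `a₂`. -/
theorem integrableOn_exp_rpow_add_rpow_sub_rpow {a₁ a₂ b : ℝ} (h₁ : 0 < a₁) (h₁b : a₁ < b)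
    (h₂ : 0 < a₂) (h₂b : a₂ < b) (c₁ c₂ : ℝ) {d : ℝ} (hd : 0 < d) :
    IntegrableOn (fun ω : ℝ => exp (-d * ω ^ b) * exp (c₁ * ω ^ a₁ + c₂ * ω ^ a₂)) (Ioi 0) := by
  obtain ⟨C₁, hC₁⟩ := exists_mul_rpow_le h₁ h₁b c₁ (d := d / 4) (by positivity)
  obtain ⟨C₂, hC₂⟩ := exists_mul_rpow_le h₂ h₂b c₂ (d := d / 4) (by positivity)
  have hb : 0 < b := h₁.trans h₁b
  have hint := (integrableOn_rpow_mul_exp_neg_mul_rpow (s := 0) (by norm_num) hb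
    (half_pos hd)).const_mul (exp (C₁ + C₂))
  refine hint.mono' (by fun_prop) ?_
  refine (ae_restrict_iff' measurableSet_Ioi).2 (.of_forall fun ω hω => ?_)
  rw [norm_of_nonneg (by positivity), rpow_zero, one_mul, ← exp_add, ← exp_add, exp_le_exp]
  linarith [hC₁ ω hω, hC₂ ω hω]

/-- Term-by-term integration of `w exp (f + g)`, both exponentials being expanded in powers. -/
theorem hasSum_integral_mul_cexp_add {μ : Measure ℝ} {w f g : ℝ → ℂ} (hw : Measurable w)
    (hf : Measurable f) (hg : Measurable g)
    (hint : Integrable (fun ω => ‖w ω‖ * exp (‖f ω‖ + ‖g ω‖)) μ) :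
    HasSum (fun i : ℕ × ℕ => ∫ ω, w ω *
        (f ω ^ i.1 / (i.1.factorial : ℂ) * (g ω ^ i.2 / (i.2.factorial : ℂ))) ∂μ)
      (∫ ω, w ω * Complex.exp (f ω + g ω) ∂μ) := by
  set F : ℕ × ℕ → ℝ → ℂ := fun i ω => w ω *
        (f ω ^ i.1 / (i.1.factorial : ℂ) * (g ω ^ i.2 / (i.2.factorial : ℂ))) with hF
  have hnorm : ∀ ω, HasSum (fun i => ‖F i ω‖) (‖w ω‖ * exp (‖f ω‖ + ‖g ω‖)) := by
    intro ω
    have h1 : ∀ y : ℝ, HasSum (fun n : ℕ => y ^ n / (n.factorial : ℝ)) (exp y) := fun y => by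
      simpa [Real.exp_eq_exp_ℝ] using NormedSpace.expSeries_div_hasSum_exp y
    have := ((h1 ‖f ω‖).mul (h1 ‖g ω‖) ((Real.summable_pow_div_factorial _).mul_of_nonneg
      (Real.summable_pow_div_factorial _) (fun _ => by positivity)
      (fun _ => by positivity))).mul_left ‖w ω‖
    rw [exp_add]
    convert! this using 2 with i
    simp [hF]
  have hval : ∀ ω, HasSum (fun i => F i ω) (w ω * Complex.exp (f ω + g ω)) := by
    intro ω
    have h1 : ∀ y : ℂ, HasSum (fun n : ℕ => y ^ n / (n.factorial : ℂ)) (Complex.exp y) := fun y => by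
      simpa [Complex.exp_eq_exp_ℂ] using NormedSpace.expSeries_div_hasSum_exp y
    have hs : ∀ y : ℂ, Summable (fun n : ℕ => ‖y ^ n / (n.factorial : ℂ)‖) := fun y => by
      simpa using Real.summable_pow_div_factorial ‖y‖
    have hm := summable_mul_of_summable_norm (f := fun n : ℕ => f ω ^ n / (n.factorial : ℂ))
      (g := fun n : ℕ => g ω ^ n / (n.factorial : ℂ)) (hs _) (hs _)
    have := ((h1 (f ω)).mul (h1 (g ω)) hm).mul_left (w ω)
    rwa [← Complex.exp_add] at this
  have hFm : ∀ i, Measurable (F i) := fun i => by fun_prop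
  have hFint : ∀ i, Integrable (F i) μ := fun i =>
    hint.mono' (hFm i).aestronglyMeasurable (.of_forall fun ω =>
      le_hasSum (hnorm ω) i fun _ _ => norm_nonneg _)
  have hsum : Summable fun i => ∫ ω, ‖F i ω‖ ∂μ := by
    refine summable_of_sum_le (c := ∫ ω, ‖w ω‖ * exp (‖f ω‖ + ‖g ω‖) ∂μ)
      (fun i => integral_nonneg fun _ => norm_nonneg _) fun s => ?_
    rw [← integral_finsetSum _ fun i _ => (hFint i).norm]
    exact integral_mono (integrable_finsetSum _ fun i _ => (hFint i).norm) hint fun ω =>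
      sum_le_hasSum _ (fun _ _ => norm_nonneg _) (hnorm ω)
  have := hasSum_integral_of_summable_integral_norm hFint hsum
  simpa only [(hval _).tsum_eq] using this

/-- The double series for `∫₀^∞ exp (-z ω ^ b + p ω ^ a₁ + q ω ^ a₂) dω`, with `b` the largest of
the exponents and `z` in the right half-plane. -/
theorem hasSum_integral_cexp_rpow {a₁ a₂ b : ℝ} (h₁ : 0 < a₁) (h₁b : a₁ < b)
    (h₂ : 0 < a₂) (h₂b : a₂ < b) {z : ℂ} (hz : 0 < z.re) (p q : ℂ) :
    HasSum (fun i : ℕ × ℕ => p ^ i.1 / (i.1.factorial : ℂ) * (q ^ i.2 / (i.2.factorial : ℂ)) *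
        (z ^ ((-((1 + a₁ * i.1 + a₂ * i.2) / b) : ℝ) : ℂ) *
          ((1 / b * Gamma ((1 + a₁ * i.1 + a₂ * i.2) / b) : ℝ) : ℂ)))
      (∫ ω in Ioi (0 : ℝ), Complex.exp (-z * ((ω ^ b : ℝ) : ℂ)) *
        Complex.exp (p * ((ω ^ a₁ : ℝ) : ℂ) + q * ((ω ^ a₂ : ℝ) : ℂ))) := by
  have hb : 0 < b := h₁.trans h₁b
  have hint : IntegrableOn (fun ω : ℝ => ‖Complex.exp (-z * ((ω ^ b : ℝ) : ℂ))‖ *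
      exp (‖p * ((ω ^ a₁ : ℝ) : ℂ)‖ + ‖q * ((ω ^ a₂ : ℝ) : ℂ)‖)) (Ioi 0) := by
    refine (integrableOn_exp_rpow_add_rpow_sub_rpow h₁ h₁b h₂ h₂b ‖p‖ ‖q‖ hz).congr_fun
      (fun ω hω => ?_) measurableSet_Ioi
    have hω0 : (0 : ℝ) ≤ ω := le_of_lt hω
    simp only [Complex.norm_exp, norm_mul, Complex.norm_real, Complex.re_mul_ofReal,
      Complex.neg_re, norm_of_nonneg (rpow_nonneg hω0 _)]
  have := hasSum_integral_mul_cexp_add (by fun_prop) (by fun_prop) (by fun_prop) hint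
  convert! this using 2 with i
  have he : -1 < a₁ * i.1 + a₂ * i.2 := by
    have : 0 ≤ a₁ * i.1 + a₂ * i.2 := by positivity
    linarith
  have := integral_rpow_mul_cexp_neg_mul_rpow hb he hz
  rw [show -((1 + a₁ * i.1 + a₂ * i.2) / b) = -(a₁ * i.1 + a₂ * i.2 + 1) / b by ring,
    show (1 + a₁ * i.1 + a₂ * i.2) / b = (a₁ * i.1 + a₂ * i.2 + 1) / b by ring, ← this,
    ← integral_const_mul]
  refine setIntegral_congr_fun measurableSet_Ioi fun ω hω => ?_
  have hω0 : (0 : ℝ) < ω := hω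
  simp only [rpow_add hω0, rpow_mul hω0.le, rpow_natCast]
  push_cast
  ring

/-- The double series of `hasSum_integral_cexp_rpow` persists on the boundary `Re z = 0`, except at
`z = 0`, provided the integral converges absolutely there. It is the limit of the series at `z + ε`:
as `‖z + ε‖ ≥ ‖z‖`, both sides are dominated uniformly in `ε > 0`. -/
theorem hasSum_integral_cexp_rpow_of_re_nonneg {a₁ a₂ b : ℝ} (h₁ : 0 < a₁) (h₁b : a₁ < b)
    (h₂ : 0 < a₂) (h₂b : a₂ < b) {z : ℂ} (hz : 0 ≤ z.re) (hz0 : z ≠ 0) (p q : ℂ)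
    (hint : IntegrableOn (fun ω : ℝ =>
      Complex.exp (p * ((ω ^ a₁ : ℝ) : ℂ) + q * ((ω ^ a₂ : ℝ) : ℂ))) (Ioi 0)) :
    HasSum (fun i : ℕ × ℕ => p ^ i.1 / (i.1.factorial : ℂ) * (q ^ i.2 / (i.2.factorial : ℂ)) *
        (z ^ ((-((1 + a₁ * i.1 + a₂ * i.2) / b) : ℝ) : ℂ) *
          ((1 / b * Gamma ((1 + a₁ * i.1 + a₂ * i.2) / b) : ℝ) : ℂ)))
      (∫ ω in Ioi (0 : ℝ), Complex.exp (-z * ((ω ^ b : ℝ) : ℂ)) *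
        Complex.exp (p * ((ω ^ a₁ : ℝ) : ℂ) + q * ((ω ^ a₂ : ℝ) : ℂ))) := by
  have hb : 0 < b := h₁.trans h₁b
  set T : ℂ → ℕ × ℕ → ℂ := fun z i =>
    p ^ i.1 / (i.1.factorial : ℂ) * (q ^ i.2 / (i.2.factorial : ℂ)) *
        (z ^ ((-((1 + a₁ * i.1 + a₂ * i.2) / b) : ℝ) : ℂ) *
          ((1 / b * Gamma ((1 + a₁ * i.1 + a₂ * i.2) / b) : ℝ) : ℂ)) with hT
  have hbound : Summable fun i => ‖T ‖z‖ i‖ :=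
    (hasSum_integral_cexp_rpow h₁ h₁b h₂ h₂b (z := (‖z‖ : ℂ)) (by simpa using hz0) p q).summable.norm
  have hle : ∀ w : ℂ, ‖z‖ ≤ ‖w‖ → ∀ i, ‖T w i‖ ≤ ‖T ‖z‖ i‖ := by
    intro w hw i
    simp only [hT, norm_mul]
    rw [Complex.norm_cpow_real, Complex.norm_cpow_real,
      Complex.norm_real ‖z‖, norm_norm]
    have hexp : -((1 + a₁ * i.1 + a₂ * i.2) / b) ≤ 0 := neg_nonpos.2 (by positivity)
    have := rpow_le_rpow_of_nonpos (norm_pos_iff.2 hz0) hw hexp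
    gcongr
  have hnorm : ∀ ε : ℝ, 0 ≤ ε → ‖z‖ ≤ ‖z + ε‖ := by
    intro ε hε
    rw [Complex.norm_def, Complex.norm_def, Complex.normSq_apply, Complex.normSq_apply]
    apply sqrt_le_sqrt
    simp only [Complex.add_re, Complex.ofReal_re, Complex.add_im, Complex.ofReal_im, add_zero]
    nlinarith [mul_nonneg hz hε]
  have hslit : z ∈ Complex.slitPlane := by
    rcases hz.lt_or_eq with h | h
    · exact Or.inl h
    · exact Or.inr fun h' => hz0 (Complex.ext h.symm h')
  have hcont : Filter.Tendsto (fun ε : ℝ => z + (ε : ℂ)) (nhdsWithin 0 (Ioi 0)) (nhds z) := by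
    have : Continuous fun ε : ℝ => z + (ε : ℂ) := by fun_prop
    simpa using (this.tendsto 0).mono_left nhdsWithin_le_nhds
  have hlimT : Filter.Tendsto (fun ε : ℝ => ∑' i, T (z + ε) i) (nhdsWithin 0 (Ioi 0))
      (nhds (∑' i, T z i)) := by
    refine tendsto_tsum_of_dominated_convergence hbound (fun i => ?_) ?_
    · exact (((continuousAt_cpow_const hslit).tendsto.comp hcont).mul_const _).const_mul _
    · filter_upwards [self_mem_nhdsWithin] with ε hε i
      exact hle _ (hnorm ε (le_of_lt hε)) i
  have hlimI : Filter.Tendsto (fun ε : ℝ => ∫ ω in Ioi (0 : ℝ),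
        Complex.exp (-(z + ε) * ((ω ^ b : ℝ) : ℂ)) *
          Complex.exp (p * ((ω ^ a₁ : ℝ) : ℂ) + q * ((ω ^ a₂ : ℝ) : ℂ))) (nhdsWithin 0 (Ioi 0))
      (nhds (∫ ω in Ioi (0 : ℝ), Complex.exp (-z * ((ω ^ b : ℝ) : ℂ)) *
        Complex.exp (p * ((ω ^ a₁ : ℝ) : ℂ) + q * ((ω ^ a₂ : ℝ) : ℂ)))) := by
    refine tendsto_integral_filter_of_dominated_convergence _
      (.of_forall fun ε => by fun_prop) ?_ hint.norm (.of_forall fun ω => ?_)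
    · filter_upwards [self_mem_nhdsWithin] with ε hε
      refine (ae_restrict_iff' measurableSet_Ioi).2 (.of_forall fun ω hω => ?_)
      rw [norm_mul]
      refine mul_le_of_le_one_left (norm_nonneg _) ?_
      rw [Complex.norm_exp, Complex.re_mul_ofReal, exp_le_one_iff]
      have h1 : 0 ≤ (z + ε).re := by
        have : 0 < ε := hε
        simp only [Complex.add_re, Complex.ofReal_re]
        linarith
      have h2 : 0 ≤ ω ^ b := rpow_nonneg (le_of_lt hω) _
      rw [Complex.neg_re]
      nlinarith [mul_nonneg h1 h2]
    · exact ((Complex.continuous_exp.tendsto _).comp (hcont.neg.mul_const _)).mul_const _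
  have heq : ∀ᶠ ε : ℝ in nhdsWithin 0 (Ioi 0), ∑' i, T (z + ε) i = ∫ ω in Ioi (0 : ℝ),
        Complex.exp (-(z + ε) * ((ω ^ b : ℝ) : ℂ)) *
          Complex.exp (p * ((ω ^ a₁ : ℝ) : ℂ) + q * ((ω ^ a₂ : ℝ) : ℂ)) := by
    filter_upwards [self_mem_nhdsWithin] with ε hε
    have h1 : 0 < (z + ε).re := by
      have : 0 < ε := hε
      simp only [Complex.add_re, Complex.ofReal_re]
      linarith
    exact (hasSum_integral_cexp_rpow h₁ h₁b h₂ h₂b h1 p q).tsum_eq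
  rw [← tendsto_nhds_unique (hlimT.congr' heq) hlimI]
  exact (Summable.of_norm_bounded hbound (hle z le_rfl)).hasSum

/-! ### The kernel `H₊` -/

theorem levyIntegrand_swap (α₁ β₁ α₂ β₂ t x : ℝ) :
    levyIntegrand α₁ β₁ α₂ β₂ t x = levyIntegrand α₂ β₂ α₁ β₁ t x := by
  ext ω
  simp only [levyIntegrand]
  ring_nf

theorem levyHplus_swap (α₁ β₁ α₂ β₂ t x : ℝ) :
    levyHplus α₁ β₁ α₂ β₂ t x = levyHplus α₂ β₂ α₁ β₁ t x := by
  rw [levyHplus, levyHplus, levyIntegrand_swap]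

theorem cos_pi_div_two_mul_pos {β : ℝ} (hβ : |β| < 1) : 0 < cos (π / 2 * β) := by
  have := pi_pos
  rw [abs_lt] at hβ
  exact cos_pos_of_mem_Ioo ⟨by nlinarith, by nlinarith⟩

theorem re_cexp_I_mul_pi_div_two (β : ℝ) :
    (Complex.exp (Complex.I * π / 2 * β)).re = cos (π / 2 * β) := by
  rw [← Complex.exp_ofReal_mul_I_re]
  congr 2
  push_cast
  ring

theorem integrableOn_levyIntegrand {α₁ β₁ β₂ t : ℝ} (α₂ x : ℝ) (hα₁ : 0 < α₁) (hβ₁ : |β₁| < 1)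
    (hβ₂ : |β₂| < 1) (ht : 0 < t) :
    IntegrableOn (levyIntegrand α₁ β₁ α₂ β₂ t x) (Ioi 0) := by
  have h1 := cos_pi_div_two_mul_pos hβ₁
  have h2 := cos_pi_div_two_mul_pos hβ₂
  refine (integrableOn_rpow_mul_exp_neg_mul_rpow (s := 0) (by norm_num) hα₁
    (mul_pos ht h1)).mono' ?_ ?_
  · unfold levyIntegrand
    fun_prop
  · refine (ae_restrict_iff' measurableSet_Ioi).2 (.of_forall fun ω hω => ?_)
    have hω0 : (0 : ℝ) ≤ ω := le_of_lt hω
    rw [levyIntegrand, norm_mul, Complex.norm_exp, Complex.norm_exp, rpow_zero, one_mul]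
    have e1 : (-Complex.I * x * ω).re = 0 := by simp
    have e2 : (-(t : ℂ) * ((ω ^ α₁ : ℝ) : ℂ) * Complex.exp (Complex.I * π / 2 * β₁)
      - (t : ℂ) * ((ω ^ α₂ : ℝ) : ℂ) * Complex.exp (Complex.I * π / 2 * β₂)).re
      = -(t * cos (π / 2 * β₁)) * ω ^ α₁ - t * cos (π / 2 * β₂) * ω ^ α₂ := by
      rw [← re_cexp_I_mul_pi_div_two, ← re_cexp_I_mul_pi_div_two, Complex.sub_re, neg_mul, neg_mul,
        Complex.neg_re, ← Complex.ofReal_mul, ← Complex.ofReal_mul, Complex.re_ofReal_mul,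
        Complex.re_ofReal_mul]
      ring
    rw [e1, e2, exp_zero, one_mul, exp_le_exp]
    have : 0 ≤ t * cos (π / 2 * β₂) * ω ^ α₂ := by positivity
    linarith

/-- Real powers of a complex number given in polar form. -/
theorem cpow_ofReal_mul_cexp {r φ : ℝ} (hr : 0 < r) (h1 : -π < φ) (h2 : φ ≤ π) (y : ℝ) :
    ((r : ℂ) * Complex.exp (φ * Complex.I)) ^ (y : ℂ)
      = ((r ^ y : ℝ) : ℂ) * Complex.exp ((φ * y : ℝ) * Complex.I) := by
  have hexp : (r : ℂ) * Complex.exp (φ * Complex.I)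
      = Complex.exp ((Real.log r : ℂ) + φ * Complex.I) := by
    rw [Complex.exp_add, ← Complex.ofReal_exp, exp_log hr]
  rw [hexp, Complex.cpow_def_of_ne_zero (Complex.exp_ne_zero _),
    Complex.log_exp (by simpa using h1) (by simpa using h2), rpow_def_of_pos hr, Complex.ofReal_exp,
    ← Complex.exp_add]
  push_cast
  ring_nf

/-- Passing from a complex series in polar form to the real part of its sum. -/
theorem HasSum.re_mul_cexp {ι : Type*} {A φ : ι → ℝ} {S : ℂ}
    (h : HasSum (fun i => (A i : ℂ) * Complex.exp (φ i * Complex.I)) S) :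
    HasSum (fun i => A i * cos (φ i)) S.re ∧ Summable fun i => |A i| := by
  constructor
  · have := Complex.hasSum_re h
    simpa only [Complex.re_ofReal_mul, Complex.exp_ofReal_mul_I_re] using this
  · have := h.summable.norm
    simpa only [norm_mul, Complex.norm_exp_ofReal_mul_I, mul_one, Complex.norm_real,
      Real.norm_eq_abs] using this

/-- The double series for `H₊` in inverse powers of `x`, for exponents below `1`. -/
theorem hasSum_levyHplus_of_lt_one {α₁ β₁ α₂ β₂ t x : ℝ} (h₁ : 0 < α₁) (h₁' : α₁ < 1)
    (hβ₁ : |β₁| ≤ α₁) (h₂ : 0 < α₂) (h₂' : α₂ < 1) (hβ₂ : |β₂| ≤ α₂) (ht : 0 < t) (hx : 0 < x) :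
    HasSum (fun i : ℕ × ℕ =>
          -(1 / π) * ((-t) ^ (i.2 + i.1) / ((i.2.factorial : ℝ) * (i.1.factorial : ℝ))
            * (Gamma (1 + α₁ * i.1 + α₂ * i.2) / x ^ (1 + α₁ * i.1 + α₂ * i.2))
            * sin (π * i.1 * ((α₁ - β₁) / 2) + π * i.2 * ((α₂ - β₂) / 2))))
        (levyHplus α₁ β₁ α₂ β₂ t x) ∧
    Summable (fun i : ℕ × ℕ =>
      t ^ (i.2 + i.1) / ((i.2.factorial : ℝ) * (i.1.factorial : ℝ))
            * (Gamma (1 + α₁ * i.1 + α₂ * i.2) / x ^ (1 + α₁ * i.1 + α₂ * i.2))) := by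
  have hint := integrableOn_levyIntegrand α₂ 0 h₁ (hβ₁.trans_lt h₁') (hβ₂.trans_lt h₂') ht
  have hI : IntegrableOn (fun ω : ℝ =>
      Complex.exp ((-(t : ℂ) * Complex.exp (Complex.I * π / 2 * β₁)) * ((ω ^ α₁ : ℝ) : ℂ)
        + (-(t : ℂ) * Complex.exp (Complex.I * π / 2 * β₂)) * ((ω ^ α₂ : ℝ) : ℂ))) (Ioi 0) := by
    convert! hint using 2 with ω
    simp only [levyIntegrand, Complex.ofReal_zero, mul_zero, zero_mul, Complex.exp_zero, one_mul]
    ring_nf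
  have hz : (x : ℂ) * Complex.exp ((π / 2 : ℝ) * Complex.I) = Complex.I * x := by
    push_cast
    rw [Complex.exp_pi_div_two_mul_I, mul_comm]
  have hsum := hasSum_integral_cexp_rpow_of_re_nonneg h₁ h₁' h₂ h₂' (z := Complex.I * x)
    (by simp) (by simp [hx.ne']) _ _ hI
  have hS : (∫ ω in Ioi (0 : ℝ), Complex.exp (-(Complex.I * x) * ((ω ^ (1 : ℝ) : ℝ) : ℂ)) *
      Complex.exp ((-(t : ℂ) * Complex.exp (Complex.I * π / 2 * β₁)) * ((ω ^ α₁ : ℝ) : ℂ)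
        + (-(t : ℂ) * Complex.exp (Complex.I * π / 2 * β₂)) * ((ω ^ α₂ : ℝ) : ℂ)))
      = ∫ ω in Ioi (0 : ℝ), levyIntegrand α₁ β₁ α₂ β₂ t x ω := by
    congr 1
    ext ω
    simp only [levyIntegrand, rpow_one]
    ring_nf
  rw [hS] at hsum
  set A : ℕ × ℕ → ℝ := fun i =>
    (-t) ^ (i.2 + i.1) / ((i.2.factorial : ℝ) * (i.1.factorial : ℝ))
            * (Gamma (1 + α₁ * i.1 + α₂ * i.2) / x ^ (1 + α₁ * i.1 + α₂ * i.2)) with hA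
  have hpolar := HasSum.re_mul_cexp (A := A)
    (φ := fun i => π / 2 * β₁ * i.1 + π / 2 * β₂ * i.2
      - π / 2 * (1 + α₁ * i.1 + α₂ * i.2))
    (S := ∫ ω in Ioi (0 : ℝ), levyIntegrand α₁ β₁ α₂ β₂ t x ω) (by
      convert! hsum using 2 with i
      rw [← hz, cpow_ofReal_mul_cexp hx (by linarith [pi_pos]) (by linarith [pi_pos]), mul_pow,
        mul_pow, ← Complex.exp_nat_mul, ← Complex.exp_nat_mul, rpow_neg hx.le, hA]
      rw [show ((π / 2 * β₁ * i.1 + π / 2 * β₂ * i.2 - π / 2 * (1 + α₁ * i.1 + α₂ * i.2) : ℝ) : ℂ)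
          * Complex.I = (i.1 : ℂ) * (Complex.I * π / 2 * β₁) + (i.2 : ℂ) * (Complex.I * π / 2 * β₂)
            + ((π / 2 * -((1 + α₁ * i.1 + α₂ * i.2) / 1) : ℝ) : ℂ) * Complex.I by push_cast; ring,
        Complex.exp_add, Complex.exp_add]
      push_cast
      rw [pow_add]
      simp only [div_one]
      field_simp)
  constructor
  · rw [levyHplus]
    convert! hpolar.1.mul_left (1 / π) using 2 with i
    rw [show π / 2 * β₁ * i.1 + π / 2 * β₂ * i.2 - π / 2 * (1 + α₁ * i.1 + α₂ * i.2)
      = -(π * i.1 * ((α₁ - β₁) / 2) + π * i.2 * ((α₂ - β₂) / 2) + π / 2) by ring, cos_neg,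
      cos_add_pi_div_two]
    ring
  · convert! hpolar.2 using 2 with i
    have : 0 < Gamma (1 + α₁ * i.1 + α₂ * i.2) := Gamma_pos_of_pos (by positivity)
    rw [hA, abs_mul, abs_div, abs_pow, abs_neg, abs_of_pos ht, abs_of_pos, abs_of_pos] <;> positivity

/-- The double series for `H₊` in powers of `x`, for exponents `1 < m < M`; the factor
`exp (-t ω ^ M exp (i π βM / 2))` of the integrand is the one that is not expanded. -/
theorem hasSum_levyHplus_of_one_lt {M βM m βm u v t x : ℝ} (hm : 1 < m) (hmM : m < M)
    (hβM : |βM| < 1) (hu : u = (M - βM) / 2) (hv : v = (m - βm) / 2)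
    (ht : 0 < t) (hx : 0 < x) :
    HasSum (fun i : ℕ × ℕ =>
          1 / (π * M) * ((-1) ^ (i.1 + i.2) / ((i.1.factorial : ℝ) * (i.2.factorial : ℝ))
            * (x ^ i.2 / t ^ ((1 + i.2) / M + (m / M - 1) * i.1))
            * Gamma ((1 + i.2) / M + m / M * i.1)
            * sin (π * u * ((1 + i.2) / M) - π * i.1 * (v - u * (m / M)))))
        (levyHplus M βM m βm t x) ∧
    Summable (fun i : ℕ × ℕ =>
          1 / ((i.1.factorial : ℝ) * (i.2.factorial : ℝ))
            * (x ^ i.2 / t ^ ((1 + i.2) / M + (m / M - 1) * i.1))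
            * Gamma ((1 + i.2) / M + m / M * i.1)) := by
  have hM : 1 < M := hm.trans hmM
  have hM0 : 0 < M := by linarith
  have hm0 : 0 < m := by linarith
  have hz : (t : ℂ) * Complex.exp ((π / 2 * βM : ℝ) * Complex.I)
      = (t : ℂ) * Complex.exp (Complex.I * π / 2 * βM) := by
    push_cast
    ring_nf
  have hzre : 0 < ((t : ℂ) * Complex.exp (Complex.I * π / 2 * βM)).re := by
    rw [Complex.re_ofReal_mul, re_cexp_I_mul_pi_div_two]
    exact mul_pos ht (cos_pi_div_two_mul_pos hβM)
  have hsum := hasSum_integral_cexp_rpow hm0 hmM one_pos hM hzre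
    (-(t : ℂ) * Complex.exp (Complex.I * π / 2 * βm)) (-Complex.I * x)
  have hS : (∫ ω in Ioi (0 : ℝ), Complex.exp (-((t : ℂ) * Complex.exp (Complex.I * π / 2 * βM))
        * ((ω ^ M : ℝ) : ℂ)) *
      Complex.exp ((-(t : ℂ) * Complex.exp (Complex.I * π / 2 * βm)) * ((ω ^ m : ℝ) : ℂ)
        + (-Complex.I * x) * ((ω ^ (1 : ℝ) : ℝ) : ℂ)))
      = ∫ ω in Ioi (0 : ℝ), levyIntegrand M βM m βm t x ω := by
    congr 1
    ext ω
    simp only [levyIntegrand, rpow_one, ← Complex.exp_add]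
    ring_nf
  rw [hS] at hsum
  set A : ℕ × ℕ → ℝ := fun i =>
    (-1) ^ i.1 / ((i.1.factorial : ℝ) * (i.2.factorial : ℝ))
            * (x ^ i.2 / t ^ ((1 + i.2) / M + (m / M - 1) * i.1))
            * Gamma ((1 + i.2) / M + m / M * i.1) with hA
  have hexp : ∀ i : ℕ × ℕ, (1 + m * i.1 + 1 * i.2) / M = (1 + i.2) / M + m / M * i.1 := by
    intro i
    field_simp
    ring
  have htpow : ∀ i : ℕ × ℕ, t ^ (-((1 + i.2) / M + m / M * i.1))
      = (t ^ i.1 * t ^ ((1 + i.2) / M + (m / M - 1) * i.1))⁻¹ := by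
    intro i
    rw [rpow_neg ht.le, ← rpow_natCast, ← rpow_add ht]
    ring_nf
  have hpolar := HasSum.re_mul_cexp (A := fun i => 1 / M * A i)
    (φ := fun i => π / 2 * βm * i.1 - π / 2 * i.2
      - π / 2 * βM * ((1 + i.2) / M + m / M * i.1))
    (S := ∫ ω in Ioi (0 : ℝ), levyIntegrand M βM m βm t x ω) (by
      have hβ := abs_lt.1 hβM
      have hpi := pi_pos
      convert! hsum using 2 with i
      rw [← hz, cpow_ofReal_mul_cexp ht (by nlinarith) (by nlinarith), mul_pow,
        mul_pow, ← Complex.exp_nat_mul, hexp, htpow, hA,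
        ← Complex.exp_neg_pi_div_two_mul_I, ← Complex.exp_nat_mul]
      rw [show ((π / 2 * βm * i.1 - π / 2 * i.2
          - π / 2 * βM * ((1 + i.2) / M + m / M * i.1) : ℝ) : ℂ)
          * Complex.I = (i.1 : ℂ) * (Complex.I * π / 2 * βm) + (i.2 : ℂ) * (-π / 2 * Complex.I)
            + ((π / 2 * βM * -((1 + i.2) / M + m / M * i.1) : ℝ) : ℂ) * Complex.I by
            push_cast; ring,
        Complex.exp_add, Complex.exp_add, neg_pow (t : ℂ)]
      have ht' : (t : ℂ) ≠ 0 := by exact_mod_cast ht.ne'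
      push_cast
      field_simp)
  constructor
  · rw [levyHplus]
    convert! hpolar.1.mul_left (1 / π) using 2 with i
    rw [show π / 2 * βm * i.1 - π / 2 * i.2 - π / 2 * βM * ((1 + i.2) / M + m / M * i.1)
      = (π * u * ((1 + i.2) / M) - π * i.1 * (v - u * (m / M))) - π / 2 - i.2 * π by
        rw [hu, hv]; field_simp; ring, cos_sub_nat_mul_pi, cos_sub_pi_div_two, hA]
    field_simp
    ring
  · have := hpolar.2.mul_left M
    convert! this using 2 with i
    have : 0 < Gamma ((1 + i.2) / M + m / M * i.1) := Gamma_pos_of_pos (by positivity)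
    have hsign : 1 / M * A i = (-1) ^ i.1 * (1 / M * (1 / ((i.1.factorial : ℝ) * (i.2.factorial : ℝ))
        * (x ^ i.2 / t ^ ((1 + i.2) / M + (m / M - 1) * i.1))
        * Gamma ((1 + i.2) / M + m / M * i.1))) := by
      rw [hA]
      ring
    rw [hsign, abs_mul, abs_neg_one_pow, one_mul, abs_of_pos (by positivity), ← mul_assoc,
      mul_one_div_cancel hM0.ne', one_mul]

/-! ### Hypergeometric form of the double series -/

theorem summable_hypergeomTerm_deltaList {P Q : ℕ} (hP : 0 < P) (hQ : 0 < Q) {s : ℝ} (hs : 0 < s)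
    (j : ℕ) {c w z : ℝ} (hc : c ≠ 0) (hz : z = w * ((P : ℝ) ^ P / (Q : ℝ) ^ Q))
    (h : Summable fun n : ℕ => c * |w| ^ n * (Gamma (s + (P * n : ℕ)) / (j + Q * n).factorial)) :
    Summable (hypergeomTerm (1 :: deltaList P s) (deltaList Q (1 + j)) z) := by
  have hG : Gamma s / j.factorial ≠ 0 :=
    div_ne_zero (Gamma_pos_of_pos hs).ne' (Nat.cast_ne_zero.2 (Nat.factorial_ne_zero _))
  rw [← summable_mul_left_iff hG, ← summable_abs_iff]
  refine (h.mul_left c⁻¹).congr fun n => ?_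
  have : 0 < Gamma (s + (P * n : ℕ)) := Gamma_pos_of_pos (by positivity)
  rw [hypergeomTerm_deltaList hP hQ hs j w z hz, abs_mul, abs_pow,
    abs_of_pos (div_pos this (by positivity)), mul_assoc, inv_mul_cancel_left₀ hc]

/-- A double series over `(r, N)` whose terms along each class `N = j + Q n` carry the factor
`w ^ n Γ(s + P n) / (j + Q n)!` is a series over `r` of finite sums of hypergeometric functions. -/
theorem HasSum.hypergeomPFQ_deltaList {P Q : ℕ} (hP : 0 < P) (hQ : 0 < Q) {s c : ℕ → ℕ → ℝ}
    (hs : ∀ r j, 0 < s r j) {w z S : ℝ} (hz : z = w * ((P : ℝ) ^ P / (Q : ℝ) ^ Q))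
    {T : ℕ × ℕ → ℝ} (hT : HasSum T S)
    (hTw : ∀ r j n, T (r, j + Q * n)
      = c r j * (w ^ n * (Gamma (s r j + (P * n : ℕ)) / (j + Q * n).factorial))) :
    HasSum (fun r => ∑ j ∈ Finset.range Q, c r j * (Gamma (s r j) / j.factorial *
      hypergeomPFQ (1 :: deltaList P (s r j)) (deltaList Q (1 + j)) z)) S := by
  convert! hT.sum_range_tsum hQ using 2 with r
  refine Finset.sum_congr rfl fun j _ => ?_
  rw [hypergeomPFQ, ← tsum_mul_left, ← tsum_mul_left]
  exact tsum_congr fun n => by rw [hTw, hypergeomTerm_deltaList hP hQ (hs r j) j w z hz]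

/-- The hypergeometric form for exponents below `1`. Here `M Q = P` and `Q u = U` are integers, so
raising the index of the larger exponent `M` by `Q` shifts the argument of `Γ` by `P` and multiplies
the sine by `(-1) ^ U`. -/
theorem hypergeometric_levyHplus_of_lt_one {M βM m βm u v t x : ℝ} {P Q : ℕ} {U : ℤ}
    (hQ : 0 < Q) (hMQ : M * Q = P) (hU : (U : ℝ) = Q * u)
    (hu : u = (M - βM) / 2) (hv : v = (m - βm) / 2)
    (hM : 0 < M) (hM' : M < 1) (hβM : |βM| ≤ M) (hm : 0 < m) (hm' : m < 1) (hβm : |βm| ≤ m)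
    (ht : 0 < t) (hx : 0 < x) :
    (∀ r j : ℕ, Summable (hypergeomTerm
          (1 :: deltaList P (1 + M * j + m * r)) (deltaList Q (1 + j))
          ((-1) ^ (U - (Q : ℤ)) * (t ^ Q * (P : ℝ) ^ P / ((Q : ℝ) ^ Q * x ^ P))))) ∧
      HasSum (fun r : ℕ =>
          -(1 / π) * ∑ j ∈ Finset.range Q,
            (-t) ^ (r + j) / ((r.factorial : ℝ) * (j.factorial : ℝ))
            * (Gamma (1 + M * j + m * r) / x ^ (1 + M * j + r * m))
            * sin (r * π * v + j * π * u)
            * hypergeomPFQ (1 :: deltaList P (1 + M * j + m * r)) (deltaList Q (1 + j))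
              ((-1) ^ (U - (Q : ℤ)) * (t ^ Q * (P : ℝ) ^ P / ((Q : ℝ) ^ Q * x ^ P))))
        (levyHplus m βm M βM t x) := by
  have hP : 0 < P := by
    have : (0 : ℝ) < P := by rw [← hMQ]; positivity
    exact_mod_cast this
  set w : ℝ := (-1) ^ (U - (Q : ℤ)) * (t ^ Q / x ^ P) with hw
  have hz : (-1) ^ (U - (Q : ℤ)) * (t ^ Q * (P : ℝ) ^ P / ((Q : ℝ) ^ Q * x ^ P))
      = w * ((P : ℝ) ^ P / (Q : ℝ) ^ Q) := by
    rw [hw]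
    field_simp
  have hwabs : |w| = t ^ Q / x ^ P := by
    rw [hw, abs_mul, abs_neg_one_zpow, one_mul, abs_of_pos (by positivity)]
  have hwU : w = (-1) ^ U * ((-t) ^ Q / x ^ P) := by
    rw [hw, zpow_sub₀ (by norm_num), zpow_natCast, neg_pow t]
    rcases neg_one_pow_eq_or ℝ Q with h | h <;> rw [h] <;> ring
  have hs : ∀ r j : ℕ, 0 < 1 + M * j + m * r := fun r j => by positivity
  -- taking `m` first makes `i.1` the index of `m` and `i.2`, which gets regrouped, that of `M`
  obtain ⟨hT, hK⟩ := hasSum_levyHplus_of_lt_one hm hm' hβm hM hM' hβM ht hx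
  have harg : ∀ r j n : ℕ, 1 + m * (r : ℝ) + M * ((j + Q * n : ℕ) : ℝ)
      = 1 + M * j + m * r + (P * n : ℕ) := by
    intro r j n
    push_cast
    rw [← hMQ]
    ring
  have hxpow : ∀ r j n : ℕ, x ^ (1 + M * (j : ℝ) + m * r + (P * n : ℕ))
      = x ^ (1 + M * (j : ℝ) + m * r) * (x ^ P) ^ n := by
    intro r j n
    rw [rpow_add_natCast hx.ne', pow_mul]
  refine ⟨fun r j => ?_, ?_⟩
  · refine summable_hypergeomTerm_deltaList hP hQ (hs r j) j
      (c := t ^ (r + j) / (r.factorial * x ^ (1 + M * (j : ℝ) + m * r))) (by positivity) hz ?_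
    refine (summable_comp_add_mul hK hQ r j).congr fun n => ?_
    dsimp only
    rw [harg, hxpow, hwabs, div_pow, ← pow_mul t, show j + Q * n + r = (r + j) + Q * n by ring,
      pow_add]
    field_simp
  · have := HasSum.hypergeomPFQ_deltaList hP hQ hs hz hT
      (c := fun r j => -(1 / π) * ((-t) ^ (r + j) / (r.factorial * x ^ (1 + M * (j : ℝ) + m * r))
        * sin (r * π * v + j * π * u))) (fun r j n => by
        have hsin : sin (π * r * ((m - βm) / 2) + π * ((j + Q * n : ℕ) : ℝ) * ((M - βM) / 2))
            = ((-1) ^ U) ^ n * sin (r * π * v + j * π * u) := by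
          rw [← zpow_natCast, ← zpow_mul, ← sin_add_int_mul_pi, ← hu, ← hv]
          congr 1
          push_cast
          rw [hU]
          ring
        dsimp only
        rw [harg, hxpow, hwU, hsin, mul_pow, div_pow, ← pow_mul (-t),
          show j + Q * n + r = (r + j) + Q * n by ring, pow_add]
        field_simp)
    convert! this using 2 with r
    rw [Finset.mul_sum]
    refine Finset.sum_congr rfl fun j _ => ?_
    rw [mul_comm (r : ℝ) m]
    field_simp

/-- The hypergeometric form for exponents above `1`. Here `M Q = P` and `Q u = U` are integers, so
raising the index of `x` by `P` shifts the argument of `Γ` by `Q` and multiplies the sine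
by `(-1) ^ U`. -/
theorem hypergeometric_levyHplus_of_one_lt {M βM m βm u v t x : ℝ} {P Q : ℕ} {U : ℤ}
    (hQ : 0 < Q) (hMQ : M * Q = P) (hU : (U : ℝ) = Q * u)
    (hu : u = (M - βM) / 2) (hv : v = (m - βm) / 2)
    (hm : 1 < m) (hmM : m < M) (hβM : |βM| < 1) (ht : 0 < t) (hx : 0 < x) :
    (∀ r j : ℕ, Summable (hypergeomTerm
          (1 :: deltaList Q ((1 + j) / M + m / M * r)) (deltaList P (1 + j))
          ((-1) ^ (U + (P : ℤ)) * ((Q : ℝ) ^ Q * x ^ P / (t ^ Q * (P : ℝ) ^ P))))) ∧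
      HasSum (fun r : ℕ =>
          1 / (π * M) * ∑ j ∈ Finset.range P,
            (-1) ^ (r + j) / ((r.factorial : ℝ) * (j.factorial : ℝ))
            * (x ^ j / t ^ ((1 + j) / M + (m / M - 1) * r))
            * Gamma ((1 + j) / M + m / M * r)
            * sin (π * u * ((1 + j) / M) - π * r * (v - u * (m / M)))
            * hypergeomPFQ (1 :: deltaList Q ((1 + j) / M + m / M * r)) (deltaList P (1 + j))
              ((-1) ^ (U + (P : ℤ)) * ((Q : ℝ) ^ Q * x ^ P / (t ^ Q * (P : ℝ) ^ P))))
        (levyHplus M βM m βm t x) := by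
  have hM0 : 0 < M := by linarith
  have hm0 : 0 < m := by linarith
  have hP : 0 < P := by
    have : (0 : ℝ) < P := by rw [← hMQ]; positivity
    exact_mod_cast this
  set w : ℝ := (-1) ^ (U + (P : ℤ)) * (x ^ P / t ^ Q) with hw
  have hz : (-1) ^ (U + (P : ℤ)) * ((Q : ℝ) ^ Q * x ^ P / (t ^ Q * (P : ℝ) ^ P))
      = w * ((Q : ℝ) ^ Q / (P : ℝ) ^ P) := by
    rw [hw]
    field_simp
  have hwabs : |w| = x ^ P / t ^ Q := by
    rw [hw, abs_mul, abs_neg_one_zpow, one_mul, abs_of_pos (by positivity)]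
  have hwU : w = (-1) ^ U * ((-1) ^ P * (x ^ P / t ^ Q)) := by
    rw [hw, zpow_add₀ (by norm_num), zpow_natCast, mul_assoc]
  have hs : ∀ r j : ℕ, 0 < (1 + j) / M + m / M * r := fun r j => by positivity
  obtain ⟨hT, hK⟩ := hasSum_levyHplus_of_one_lt hm hmM hβM hu hv ht hx
  -- the step `P` of the index of `x` shifts the argument of `Γ` by `P / M = Q`
  have hdiv : ∀ j n : ℕ, (1 + ((j + P * n : ℕ) : ℝ)) / M = (1 + j) / M + (Q * n : ℕ) := by
    intro j n
    push_cast
    rw [← hMQ]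
    field_simp
    ring
  have htpow : ∀ r j n : ℕ, t ^ ((1 + (j : ℝ)) / M + (Q * n : ℕ) + (m / M - 1) * r)
      = t ^ ((1 + (j : ℝ)) / M + (m / M - 1) * r) * (t ^ Q) ^ n := by
    intro r j n
    rw [add_right_comm, rpow_add_natCast ht.ne', pow_mul]
  refine ⟨fun r j => ?_, ?_⟩
  · refine summable_hypergeomTerm_deltaList hQ hP (hs r j) j
      (c := 1 / r.factorial * (x ^ j / t ^ ((1 + (j : ℝ)) / M + (m / M - 1) * r)))
      (by positivity) hz ?_
    refine (summable_comp_add_mul hK hP r j).congr fun n => ?_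
    dsimp only
    rw [hdiv, htpow, hwabs, div_pow, ← pow_mul x, add_right_comm ((1 + (j : ℝ)) / M), pow_add]
    field_simp
  · have := HasSum.hypergeomPFQ_deltaList hQ hP hs hz hT
      (c := fun r j => 1 / (π * M) * ((-1) ^ (r + j) / r.factorial
        * (x ^ j / t ^ ((1 + (j : ℝ)) / M + (m / M - 1) * r))
        * sin (π * u * ((1 + j) / M) - π * r * (v - u * (m / M))))) (fun r j n => by
        have hsin : sin (π * u * ((1 + (j : ℝ)) / M + (Q * n : ℕ)) - π * r * (v - u * (m / M)))
            = ((-1) ^ U) ^ n * sin (π * u * ((1 + j) / M) - π * r * (v - u * (m / M))) := by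
          rw [← zpow_natCast, ← zpow_mul, ← sin_add_int_mul_pi]
          congr 1
          push_cast
          rw [hU]
          ring
        dsimp only
        rw [hdiv, htpow, hwU, hsin, mul_pow, mul_pow, div_pow, ← pow_mul x, ← pow_mul (-1 : ℝ) P,
          add_right_comm ((1 + (j : ℝ)) / M), ← add_assoc, pow_add _ (r + j), pow_add x]
        field_simp)
    convert! this using 2 with r
    rw [Finset.mul_sum]
    refine Finset.sum_congr rfl fun j _ => ?_
    field_simp

theorem max_div_mul_mOne {l k p q : ℕ} (hk : 0 < k) (hq : 0 < q) :
    max ((l : ℝ) / k) ((p : ℝ) / q) * mOne l k p q = (l * p : ℕ) := by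
  have hk' : (0 : ℝ) < k := by exact_mod_cast hk
  have hq' : (0 : ℝ) < q := by exact_mod_cast hq
  have key : ((p : ℝ) / q ≤ (l : ℝ) / k) ↔ k * p ≤ l * q := by
    rw [div_le_div_iff₀ hq' hk', mul_comm (p : ℝ)]
    exact_mod_cast Iff.rfl
  unfold mOne
  by_cases h : k * p ≤ l * q
  · rw [max_eq_left (key.2 h), min_eq_left h]
    push_cast
    field_simp
  · rw [max_eq_right (le_of_not_ge fun h' => h (key.1 h')), min_eq_right (le_of_not_ge h)]
    push_cast
    field_simp

theorem mOne_pos {l k p q : ℕ} (hk : 0 < k) (hq : 0 < q) (hl : 0 < (l : ℝ) / k)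
    (hp : 0 < (p : ℝ) / q) : 0 < mOne l k p q := by
  have hl' : 0 < l := Nat.pos_of_ne_zero fun h => by simp [h] at hl
  have hp' : 0 < p := Nat.pos_of_ne_zero fun h => by simp [h] at hp
  exact lt_min (by positivity) (by positivity)

/-- With `α = l / k` and `β = (l - 2 c) / k`, the angle `(α - β) / 2` is `c / k`. -/
theorem sub_sub_div_div_two (l c : ℝ) (k : ℕ) : c / k = (l / k - (l - 2 * c) / k) / 2 := by
  ring

theorem mainTheorem4 :
    -- (A), double series
    (∀ α₁ β₁ α₂ β₂ t x : ℝ,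
      0 < α₁ → α₁ < 1 → |β₁| ≤ α₁ → 0 < α₂ → α₂ < 1 → |β₂| ≤ α₂ → 0 < t → 0 < x →
      IntegrableOn (levyIntegrand α₁ β₁ α₂ β₂ t x) (Ioi 0) ∧
      HasSum (fun i : ℕ × ℕ =>
          -(1 / π) * ((-t) ^ (i.2 + i.1) / ((i.2.factorial : ℝ) * (i.1.factorial : ℝ))
            * (Gamma (1 + α₁ * i.1 + α₂ * i.2) / x ^ (1 + α₁ * i.1 + α₂ * i.2))
            * sin (π * i.1 * ((α₁ - β₁) / 2) + π * i.2 * ((α₂ - β₂) / 2))))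
        (levyHplus α₁ β₁ α₂ β₂ t x)) ∧
    -- (A), hypergeometric form
    (∀ (l k p q : ℕ) (a b : ℤ) (α₁ β₁ α₂ β₂ M m u v t x : ℝ),
      0 < k → 0 < q →
      α₁ = (l : ℝ) / k → β₁ = ((l : ℝ) - 2 * a) / k →
      α₂ = (p : ℝ) / q → β₂ = ((p : ℝ) - 2 * b) / q →
      M = max α₁ α₂ → m = min α₁ α₂ →
      u = atLarger α₁ α₂ ((a : ℝ) / k) ((b : ℝ) / q) →
      v = atSmaller α₁ α₂ ((a : ℝ) / k) ((b : ℝ) / q) →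
      0 < α₁ → α₁ < 1 → |β₁| ≤ α₁ → 0 < α₂ → α₂ < 1 → |β₂| ≤ α₂ → 0 < t → 0 < x →
      (∀ r j : ℕ, j < mOne l k p q →
        Summable (hypergeomTerm
          (1 :: deltaList (l * p) (1 + M * j + m * r)) (deltaList (mOne l k p q) (1 + j))
          ((-1) ^ (mOneU l k p q a b - (mOne l k p q : ℤ))
            * (t ^ mOne l k p q * ((l * p : ℕ) : ℝ) ^ (l * p)
              / ((mOne l k p q : ℝ) ^ mOne l k p q * x ^ (l * p)))))) ∧
      HasSum (fun r : ℕ =>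
          -(1 / π) * ∑ j ∈ Finset.range (mOne l k p q),
            (-t) ^ (r + j) / ((r.factorial : ℝ) * (j.factorial : ℝ))
            * (Gamma (1 + M * j + m * r) / x ^ (1 + M * j + r * m))
            * sin (r * π * v + j * π * u)
            * hypergeomPFQ
              (1 :: deltaList (l * p) (1 + M * j + m * r)) (deltaList (mOne l k p q) (1 + j))
              ((-1) ^ (mOneU l k p q a b - (mOne l k p q : ℤ))
                * (t ^ mOne l k p q * ((l * p : ℕ) : ℝ) ^ (l * p)
                  / ((mOne l k p q : ℝ) ^ mOne l k p q * x ^ (l * p)))))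
        (levyHplus α₁ β₁ α₂ β₂ t x)) ∧
    -- (B), double series
    (∀ α₁ β₁ α₂ β₂ M m u v t x : ℝ,
      M = max α₁ α₂ → m = min α₁ α₂ →
      u = atLarger α₁ α₂ ((α₁ - β₁) / 2) ((α₂ - β₂) / 2) →
      v = atSmaller α₁ α₂ ((α₁ - β₁) / 2) ((α₂ - β₂) / 2) →
      1 < α₁ → α₁ ≤ 2 → |β₁| ≤ 2 - α₁ → 1 < α₂ → α₂ ≤ 2 → |β₂| ≤ 2 - α₂ → α₁ ≠ α₂ →
      0 < t → 0 < x →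
      IntegrableOn (levyIntegrand α₁ β₁ α₂ β₂ t x) (Ioi 0) ∧
      HasSum (fun i : ℕ × ℕ =>
          1 / (π * M) * ((-1) ^ (i.1 + i.2) / ((i.1.factorial : ℝ) * (i.2.factorial : ℝ))
            * (x ^ i.2 / t ^ ((1 + i.2) / M + (m / M - 1) * i.1))
            * Gamma ((1 + i.2) / M + m / M * i.1)
            * sin (π * u * ((1 + i.2) / M) - π * i.1 * (v - u * (m / M)))))
        (levyHplus α₁ β₁ α₂ β₂ t x)) ∧
    -- (B), hypergeometric form
    (∀ (l k p q : ℕ) (a b : ℤ) (α₁ β₁ α₂ β₂ M m u v t x : ℝ),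
      0 < k → 0 < q →
      α₁ = (l : ℝ) / k → β₁ = ((l : ℝ) - 2 * a) / k →
      α₂ = (p : ℝ) / q → β₂ = ((p : ℝ) - 2 * b) / q →
      M = max α₁ α₂ → m = min α₁ α₂ →
      u = atLarger α₁ α₂ ((a : ℝ) / k) ((b : ℝ) / q) →
      v = atSmaller α₁ α₂ ((a : ℝ) / k) ((b : ℝ) / q) →
      1 < α₁ → α₁ ≤ 2 → |β₁| ≤ 2 - α₁ → 1 < α₂ → α₂ ≤ 2 → |β₂| ≤ 2 - α₂ → α₁ ≠ α₂ →
      0 < t → 0 < x →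
      (∀ r j : ℕ, j < l * p →
        Summable (hypergeomTerm
          (1 :: deltaList (mOne l k p q) ((1 + j) / M + m / M * r)) (deltaList (l * p) (1 + j))
          ((-1) ^ (mOneU l k p q a b + ((l * p : ℕ) : ℤ))
            * ((mOne l k p q : ℝ) ^ mOne l k p q * x ^ (l * p)
              / (t ^ mOne l k p q * ((l * p : ℕ) : ℝ) ^ (l * p)))))) ∧
      HasSum (fun r : ℕ =>
          1 / (π * M) * ∑ j ∈ Finset.range (l * p),
            (-1) ^ (r + j) / ((r.factorial : ℝ) * (j.factorial : ℝ))
            * (x ^ j / t ^ ((1 + j) / M + (m / M - 1) * r))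
            * Gamma ((1 + j) / M + m / M * r)
            * sin (π * u * ((1 + j) / M) - π * r * (v - u * (m / M)))
            * hypergeomPFQ
              (1 :: deltaList (mOne l k p q) ((1 + j) / M + m / M * r)) (deltaList (l * p) (1 + j))
              ((-1) ^ (mOneU l k p q a b + ((l * p : ℕ) : ℤ))
                * ((mOne l k p q : ℝ) ^ mOne l k p q * x ^ (l * p)
                  / (t ^ mOne l k p q * ((l * p : ℕ) : ℝ) ^ (l * p)))))
        (levyHplus α₁ β₁ α₂ β₂ t x)) := by
  refine ⟨?_, ?_, ?_, ?_⟩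
  · intro α₁ β₁ α₂ β₂ t x h₁ h₁' hβ₁ h₂ h₂' hβ₂ ht hx
    exact ⟨integrableOn_levyIntegrand α₂ x h₁ (hβ₁.trans_lt h₁') (hβ₂.trans_lt h₂') ht,
      (hasSum_levyHplus_of_lt_one h₁ h₁' hβ₁ h₂ h₂' hβ₂ ht hx).1⟩
  · intro l k p q a b α₁ β₁ α₂ β₂ M m u v t x hk hq hα₁ hβ₁' hα₂ hβ₂' hM hm hu hv h₁ h₁' hβ₁ h₂ h₂'
      hβ₂ ht hx
    have hQ : 0 < mOne l k p q := mOne_pos hk hq (hα₁ ▸ h₁) (hα₂ ▸ h₂)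
    have hMQ : M * mOne l k p q = (l * p : ℕ) := by
      rw [hM, hα₁, hα₂, max_div_mul_mOne hk hq]
    have hU : (mOneU l k p q a b : ℝ) = mOne l k p q * u := by
      rw [hu, hα₁, hα₂, mOneU_eq l k p q hk hq]
    have e₁ : (a : ℝ) / k = (α₁ - β₁) / 2 := by rw [hα₁, hβ₁', ← sub_sub_div_div_two]
    have e₂ : (b : ℝ) / q = (α₂ - β₂) / 2 := by rw [hα₂, hβ₂', ← sub_sub_div_div_two]
    rw [e₁, e₂] at hu hv
    by_cases h : α₂ ≤ α₁
    · rw [atLarger, if_pos h] at hu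
      rw [atSmaller, if_pos h] at hv
      rw [max_eq_left h] at hM
      rw [min_eq_right h] at hm
      subst hM hm
      have := hypergeometric_levyHplus_of_lt_one hQ hMQ hU hu hv h₁ h₁' hβ₁ h₂ h₂' hβ₂ ht hx
      rw [levyHplus_swap]
      exact ⟨fun r j _ => this.1 r j, this.2⟩
    · rw [atLarger, if_neg h] at hu
      rw [atSmaller, if_neg h] at hv
      rw [max_eq_right (le_of_not_ge h)] at hM
      rw [min_eq_left (le_of_not_ge h)] at hm
      subst hM hm
      have := hypergeometric_levyHplus_of_lt_one hQ hMQ hU hu hv h₂ h₂' hβ₂ h₁ h₁' hβ₁ ht hx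
      exact ⟨fun r j _ => this.1 r j, this.2⟩
  · intro α₁ β₁ α₂ β₂ M m u v t x hM hm hu hv h₁ h₁' hβ₁ h₂ h₂' hβ₂ hne ht hx
    have hβ₁1 : |β₁| < 1 := by linarith
    have hβ₂1 : |β₂| < 1 := by linarith
    refine ⟨integrableOn_levyIntegrand α₂ x (by linarith) hβ₁1 hβ₂1 ht, ?_⟩
    by_cases h : α₂ ≤ α₁
    · rw [atLarger, if_pos h] at hu
      rw [atSmaller, if_pos h] at hv
      rw [max_eq_left h] at hM
      rw [min_eq_right h] at hm
      subst hM hm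
      exact (hasSum_levyHplus_of_one_lt h₂ (lt_of_le_of_ne h hne.symm) hβ₁1 hu hv ht hx).1
    · rw [atLarger, if_neg h] at hu
      rw [atSmaller, if_neg h] at hv
      rw [max_eq_right (le_of_not_ge h)] at hM
      rw [min_eq_left (le_of_not_ge h)] at hm
      subst hM hm
      rw [levyHplus_swap]
      exact (hasSum_levyHplus_of_one_lt h₁ (lt_of_not_ge h) hβ₂1 hu hv ht hx).1
  · intro l k p q a b α₁ β₁ α₂ β₂ M m u v t x hk hq hα₁ hβ₁' hα₂ hβ₂' hM hm hu hv h₁ h₁' hβ₁ h₂ h₂'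
      hβ₂ hne ht hx
    have hβ₁1 : |β₁| < 1 := by linarith
    have hβ₂1 : |β₂| < 1 := by linarith
    have hQ : 0 < mOne l k p q := mOne_pos hk hq (hα₁ ▸ by linarith) (hα₂ ▸ by linarith)
    have hMQ : M * mOne l k p q = (l * p : ℕ) := by
      rw [hM, hα₁, hα₂, max_div_mul_mOne hk hq]
    have hU : (mOneU l k p q a b : ℝ) = mOne l k p q * u := by
      rw [hu, hα₁, hα₂, mOneU_eq l k p q hk hq]
    have e₁ : (a : ℝ) / k = (α₁ - β₁) / 2 := by rw [hα₁, hβ₁', ← sub_sub_div_div_two]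
    have e₂ : (b : ℝ) / q = (α₂ - β₂) / 2 := by rw [hα₂, hβ₂', ← sub_sub_div_div_two]
    rw [e₁, e₂] at hu hv
    by_cases h : α₂ ≤ α₁
    · rw [atLarger, if_pos h] at hu
      rw [atSmaller, if_pos h] at hv
      rw [max_eq_left h] at hM
      rw [min_eq_right h] at hm
      subst hM hm
      have := hypergeometric_levyHplus_of_one_lt hQ hMQ hU hu hv h₂ (lt_of_le_of_ne h hne.symm)
        hβ₁1 ht hx
      exact ⟨fun r j _ => this.1 r j, this.2⟩
    · rw [atLarger, if_neg h] at hu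
      rw [atSmaller, if_neg h] at hv
      rw [max_eq_right (le_of_not_ge h)] at hM
      rw [min_eq_left (le_of_not_ge h)] at hm
      subst hM hm
      have := hypergeometric_levyHplus_of_one_lt hQ hMQ hU hu hv h₁ (lt_of_not_ge h) hβ₂1 ht hx
      rw [levyHplus_swap]
      exact ⟨fun r j _ => this.1 r j, this.2⟩
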